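/- Let $K\subset\mathbb R^n$ be a polytope (the convex hull of finitely many points) that is symmetric ($x\in K$ implies $-x\in K$) and has volume $|K|=1$. For real $p\ge 1$ let $Z_p(K)$ be the $L_p$-centroid body of $K$, that is, the closed convex set with support function $$h_{Z_p(K)}(\theta)=\left(\int_K|\langle x,\theta\rangle|^p\,dx\right)^{1/p},$$ and for $C\subset\mathbb R^n$ let $C^\circ=\{y\in\mathbb R^n:\langle x,y\rangle\le 1\text{ for all }x\in C\}$ be its polar. Write $Z_p^\circ(K)=(Z_p(K))^\circ$ and let $|\cdot|$ denote volume. Then $$\lim_{p\to\infty}\frac{p}{\log p}\left(|Z_p^\circ(K)|-|K^\circ|\right)=n^2\,|K^\circ| .$$ -/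

import Mathlib

open MeasureTheory Filter Topology
open scoped RealInnerProductSpace

/-- A polytope in `ℝⁿ`: the convex hull of finitely many points. -/
def IsPolytope {n : ℕ} (K : Set (EuclideanSpace ℝ (Fin n))) : Prop :=
  ∃ S : Set (EuclideanSpace ℝ (Fin n)), S.Finite ∧ K = convexHull ℝ S

/-- A set is (origin-)symmetric if `x ∈ K` implies `-x ∈ K`. -/
def IsOriginSymmetric {n : ℕ} (K : Set (EuclideanSpace ℝ (Fin n))) : Prop :=
  ∀ x ∈ K, -x ∈ K

/-- The polar body `C° = {y : ⟪x, y⟫ ≤ 1 for all x ∈ C}`. -/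
def polarBody {n : ℕ} (C : Set (EuclideanSpace ℝ (Fin n))) : Set (EuclideanSpace ℝ (Fin n)) :=
  {y | ∀ x ∈ C, ⟪x, y⟫ ≤ 1}

/-- The function `θ ↦ (∫_K |⟪x, θ⟫| ^ p dx) ^ (1 / p)`. -/
noncomputable def lpCentroidSupport {n : ℕ} (p : ℝ) (K : Set (EuclideanSpace ℝ (Fin n)))
    (θ : EuclideanSpace ℝ (Fin n)) : ℝ :=
  (∫ x in K, |⟪x, θ⟫| ^ p) ^ (1 / p)

/-- The `L_p`-centroid body `Z_p(K)`: the closed convex set with support function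
`lpCentroidSupport p K`, that is, the intersection of the half-spaces
`{x : ⟪x, θ⟫ ≤ lpCentroidSupport p K θ}`. That its support function is indeed
`lpCentroidSupport p K` is `isGreatest_lpCentroidBody`. -/
def lpCentroidBody {n : ℕ} (p : ℝ) (K : Set (EuclideanSpace ℝ (Fin n))) :
    Set (EuclideanSpace ℝ (Fin n)) :=
  {x | ∀ θ, ⟪x, θ⟫ ≤ lpCentroidSupport p K θ}

/-- `lpCentroidSupport` is the `L^p` seminorm of `x ↦ ⟪x, θ⟫` on `K`. -/
theorem lpCentroidSupport_eq_toReal_eLpNorm {n : ℕ} {p : ℝ} (hp : 1 ≤ p)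
    {K : Set (EuclideanSpace ℝ (Fin n))} (hK : IsCompact K) (θ : EuclideanSpace ℝ (Fin n)) :
    MemLp (fun x => ⟪x, θ⟫) (ENNReal.ofReal p) (volume.restrict K) ∧
    lpCentroidSupport p K θ =
      (eLpNorm (fun x => ⟪x, θ⟫) (ENNReal.ofReal p) (volume.restrict K)).toReal := by
  have hc : Continuous (fun x : EuclideanSpace ℝ (Fin n) => ⟪x, θ⟫) := by fun_prop
  have hp0 : 0 < p := by linarith
  have h1 : ENNReal.ofReal p ≠ 0 := by simpa using hp0
  have hi : Integrable (fun x : EuclideanSpace ℝ (Fin n) => ‖⟪x, θ⟫‖ ^ p)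
      (volume.restrict K) :=
    (((hc.norm).rpow_const (fun _ => Or.inr hp0.le)).continuousOn).integrableOn_compact hK
  have hm : MemLp (fun x => ⟪x, θ⟫) (ENNReal.ofReal p) (volume.restrict K) := by
    rw [← integrable_norm_rpow_iff hc.aestronglyMeasurable h1 ENNReal.ofReal_ne_top,
      ENNReal.toReal_ofReal hp0.le]
    exact hi
  refine ⟨hm, ?_⟩
  rw [hm.eLpNorm_eq_integral_rpow_norm h1 ENNReal.ofReal_ne_top,
    ENNReal.toReal_ofReal hp0.le, ENNReal.toReal_ofReal (by positivity)]
  simp [lpCentroidSupport, Real.norm_eq_abs]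

/-- For compact `K` and `p ≥ 1`, the support function of `Z_p(K)` is `lpCentroidSupport p K`. -/
theorem isGreatest_lpCentroidBody {n : ℕ} {p : ℝ} (hp : 1 ≤ p)
    {K : Set (EuclideanSpace ℝ (Fin n))} (hK : IsCompact K) (θ : EuclideanSpace ℝ (Fin n)) :
    IsGreatest ((fun x => ⟪x, θ⟫) '' lpCentroidBody p K) (lpCentroidSupport p K θ) := by
  have key := lpCentroidSupport_eq_toReal_eLpNorm hp hK
  have hsmul : ∀ c : ℝ, 0 < c → ∀ u : EuclideanSpace ℝ (Fin n),
      lpCentroidSupport p K (c • u) = c * lpCentroidSupport p K u := by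
    intro c hc u
    have he : (fun x : EuclideanSpace ℝ (Fin n) => ⟪x, c • u⟫) = c • (fun x => ⟪x, u⟫) := by
      ext x
      simp [inner_smul_right]
    rw [(key _).2, (key _).2, he, eLpNorm_const_smul, ENNReal.toReal_mul]
    simp [abs_of_pos hc]
  have hadd : ∀ u v : EuclideanSpace ℝ (Fin n),
      lpCentroidSupport p K (u + v) ≤ lpCentroidSupport p K u + lpCentroidSupport p K v := by
    intro u v
    have he : (fun x : EuclideanSpace ℝ (Fin n) => ⟪x, u + v⟫)
        = (fun x => ⟪x, u⟫) + (fun x => ⟪x, v⟫) := by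
      ext x
      simp [inner_add_right]
    rw [(key _).2, (key _).2, (key _).2, he,
      ← ENNReal.toReal_add (key u).1.eLpNorm_ne_top (key v).1.eLpNorm_ne_top]
    exact ENNReal.toReal_mono
      (ENNReal.add_ne_top.2 ⟨(key u).1.eLpNorm_ne_top, (key v).1.eLpNorm_ne_top⟩)
      (eLpNorm_add_le (key u).1.aestronglyMeasurable (key v).1.aestronglyMeasurable
        (by simpa using hp))
  have hnn : ∀ u : EuclideanSpace ℝ (Fin n), 0 ≤ lpCentroidSupport p K u := by
    intro u
    rw [(key u).2]
    exact ENNReal.toReal_nonneg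
  have hneg : ∀ u : EuclideanSpace ℝ (Fin n),
      lpCentroidSupport p K (-u) = lpCentroidSupport p K u := by
    intro u
    simp [lpCentroidSupport]
  refine ⟨?_, ?_⟩
  · have hz : lpCentroidSupport p K (0 : EuclideanSpace ℝ (Fin n)) = 0 := by
      have := hsmul 2 two_pos 0
      rw [smul_zero] at this
      linarith
    have hspan : ∀ c : ℝ, c • θ = 0 → c • lpCentroidSupport p K θ = 0 := by
      intro c hc
      by_cases h0 : θ = 0
      · simp [h0, hz]
      · have : c = 0 := by simpa [h0] using hc
        simp [this]
    obtain ⟨g, hg1, hg2⟩ := exists_extension_of_le_sublinear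
      (LinearPMap.mkSpanSingleton' θ (lpCentroidSupport p K θ) hspan)
      (lpCentroidSupport p K) hsmul hadd (by
        rintro ⟨x, hx⟩
        obtain ⟨c, rfl⟩ := Submodule.mem_span_singleton.1 hx
        rw [LinearPMap.mkSpanSingleton'_apply]
        rcases lt_trichotomy c 0 with h | h | h
        · have h1 := hsmul (-c) (by linarith) (-θ)
          rw [hneg, smul_neg, neg_smul, neg_neg] at h1
          change c * _ ≤ lpCentroidSupport p K (c • θ)
          rw [h1]
          nlinarith [hnn θ]
        · subst h
          simp [hz]
        · exact (hsmul c h θ).ge)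
    have hθ := hg1 ⟨θ, Submodule.mem_span_singleton_self θ⟩
    have h1 := LinearPMap.mkSpanSingleton'_apply_self (σ := RingHom.id ℝ) θ
      (lpCentroidSupport p K θ) hspan (Submodule.mem_span_singleton_self θ)
    replace hθ := hθ.trans h1
    refine ⟨(InnerProductSpace.toDual ℝ _).symm (LinearMap.toContinuousLinearMap g), ?_, ?_⟩
    · intro u
      simpa using hg2 u
    · simpa using hθ
  · rintro _ ⟨x, hx, rfl⟩
    exact hx θ

/-!
Since `Z_p°(K) = {θ | ∫_K |⟪x, θ⟫| ^ p ≤ 1}`, everything rests on comparing the `p`-th moment with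
`h(θ) ^ p`, where `h` is the support function of `K`. Up to constants the quotient is `p⁻ⁿ`: the mass
of `|⟪x, θ⟫| ^ p` sits within distance of order `1 / p` from the face of `K` where `⟪x, θ⟫` is maximal,
and this face is a single vertex for almost every `θ`. So `Z_p°(K)` is roughly `K°` dilated by
`(C pⁿ) ^ (1 / p)`, whose `n`-th power is `1 + n² log p / p + O(1 / p)`; the constant `C` is invisible
after multiplication by `p / log p` (`tendsto_div_log_mul_exp_sub_one`).

* Upper bound. `K` contains the homothetic copy, with ratio `1 / p` and centre any `v ∈ K`, of its half
  `{0 ≤ ⟪x, θ⟫}`. This bounds the moment below (`inner_rpow_le_integral`) and gives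
  `Z_p°(K) ⊆ (8 pⁿ) ^ (1 / p) • K°` (`polarBody_lpCentroidBody_subset_smul`).
* Lower bound. If `K` is the convex hull of `S`, let `A` be the cone of directions in which one point of
  `S` beats all others by a relative margin `δ` (`exposedNormals`). For `θ ∈ K° ∩ A` the
  functional `⟪·, θ⟫` is at most `1` and drops linearly, relative to its maximum, away from that
  vertex, so the moment is at most `C / pⁿ` with `C` independent of `θ`
  (`exists_integral_le_of_mem_exposedNormals`). Hence `Z_p°(K)` contains a dilate of `K° ∩ A`, and it contains `K° \ A` because `K` has volume `1` (`exists_volume_real_ge`). This gives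
  the limit inferior at least `n² |K° ∩ A|`, and as `δ` decreases to `0` the cones exhaust `ℝⁿ` up to
  finitely many hyperplanes (`ae_mem_iUnion_exposedNormals`).
-/

open scoped Pointwise

/-! ### Polar bodies -/

/-- `Z_p°(K)` as a sublevel set of the `p`-th moment, which is the form in which it is estimated. -/
theorem polarBody_lpCentroidBody {n : ℕ} {p : ℝ} (hp : 1 ≤ p)
    {K : Set (EuclideanSpace ℝ (Fin n))} (hK : IsCompact K) :
    polarBody (lpCentroidBody p K) = {θ | ∫ x in K, |⟪x, θ⟫| ^ p ≤ 1} := by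
  ext θ
  have hI : 0 ≤ ∫ x in K, |⟪x, θ⟫| ^ p := integral_nonneg fun x => by positivity
  have hiff : lpCentroidSupport p K θ ≤ 1 ↔ ∫ x in K, |⟪x, θ⟫| ^ p ≤ 1 := by
    rw [lpCentroidSupport]
    have := Real.rpow_le_rpow_iff hI zero_le_one (z := 1 / p) (by positivity)
    rwa [Real.one_rpow] at this
  obtain ⟨⟨x, hx, hxθ⟩, hub⟩ := isGreatest_lpCentroidBody hp hK θ
  rw [Set.mem_ofPred_eq, ← hiff]
  constructor
  · intro h
    exact hxθ ▸ h x hx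
  · intro h y hy
    exact (hub ⟨y, hy, rfl⟩).trans h

theorem isClosed_polarBody {n : ℕ} (C : Set (EuclideanSpace ℝ (Fin n))) :
    IsClosed (polarBody C) := by
  have : polarBody C = ⋂ x ∈ C, {y | ⟪x, y⟫ ≤ 1} := by
    ext y
    simp [polarBody]
  rw [this]
  exact isClosed_biInter fun x _ => isClosed_le (by fun_prop) continuous_const

theorem isBounded_polarBody_of_mem_nhds {n : ℕ} {C : Set (EuclideanSpace ℝ (Fin n))}
    (hC : C ∈ 𝓝 0) : Bornology.IsBounded (polarBody C) := by
  obtain ⟨r, hr, hrC⟩ := Metric.nhds_basis_closedBall.mem_iff.1 hC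
  refine (Metric.isBounded_closedBall (x := 0) (r := r⁻¹)).subset fun y hy => ?_
  rw [mem_closedBall_zero_iff]
  rcases eq_or_ne y 0 with rfl | hy0
  · simpa using hr.le
  have hpos : 0 < ‖y‖ := norm_pos_iff.2 hy0
  have hmem : (r / ‖y‖) • y ∈ C := hrC (by
    rw [mem_closedBall_zero_iff, norm_smul, Real.norm_of_nonneg (by positivity),
      div_mul_cancel₀ _ hpos.ne'])
  have h := hy _ hmem
  rw [real_inner_smul_left, real_inner_self_eq_norm_sq, pow_two, ← mul_assoc,
    div_mul_cancel₀ _ hpos.ne'] at h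
  rw [← one_div, le_div_iff₀ hr, mul_comm]
  exact h

/-- A symmetric convex set of positive volume has an interior point `x`, hence also the interior
point `0`, the midpoint of `x` and `-x`. -/
theorem Convex.mem_nhds_zero_of_volume_ne_zero {n : ℕ} {K : Set (EuclideanSpace ℝ (Fin n))}
    (hconv : Convex ℝ K) (hsymm : IsOriginSymmetric K) (hvol : volume K ≠ 0) : K ∈ 𝓝 0 := by
  have hne : (interior K).Nonempty := by
    rw [Set.nonempty_iff_ne_empty]
    intro he
    refine hvol (measure_mono_null ?_ (hconv.addHaar_frontier volume))
    rw [frontier, he, Set.sdiff_empty]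
    exact subset_closure
  obtain ⟨x, hx⟩ := hne
  have h := hconv.combo_interior_self_mem_interior hx (hsymm x (interior_subset hx))
    (a := 1 / 2) (b := 1 / 2) (by norm_num) (by norm_num) (by norm_num)
  rw [smul_neg, add_neg_cancel] at h
  exact mem_interior_iff_mem_nhds.1 h

theorem integrableOn_abs_inner_rpow {n : ℕ} {p : ℝ} (hp : 0 ≤ p)
    {K : Set (EuclideanSpace ℝ (Fin n))} (hK : IsCompact K) (θ : EuclideanSpace ℝ (Fin n)) :
    IntegrableOn (fun x => |⟪x, θ⟫| ^ p) K := by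
  refine ContinuousOn.integrableOn_compact hK (Continuous.continuousOn ?_)
  exact Continuous.rpow_const (by fun_prop) fun _ => Or.inr hp

/-! ### The scaling factor -/

/-- The dilation factors used below are `(C pⁿ) ^ (1 / p)`, written as an exponential with
`a = log C`. -/
theorem exp_rpow_scale {n : ℕ} {p : ℝ} (hp : 0 < p) (a : ℝ) :
    Real.exp ((n * Real.log p + a) / p) ^ p = Real.exp a * p ^ n := by
  rw [← Real.exp_mul, div_mul_cancel₀ _ hp.ne', Real.exp_add, mul_comm (n : ℝ), Real.exp_mul,
    Real.exp_log hp, Real.rpow_natCast, mul_comm]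

theorem exp_pow_scale {n : ℕ} (p a : ℝ) :
    Real.exp ((n * Real.log p + a) / p) ^ n = Real.exp (n * ((n * Real.log p + a) / p)) := by
  rw [← Real.exp_nat_mul]

theorem volume_real_smul {n : ℕ} {r : ℝ} (hr : 0 ≤ r) (s : Set (EuclideanSpace ℝ (Fin n))) :
    volume.real (r • s) = r ^ n * volume.real s := by
  rw [measureReal_def, Measure.addHaar_smul, ENNReal.toReal_mul,
    ENNReal.toReal_ofReal (abs_nonneg _), abs_of_nonneg (by positivity), ← measureReal_def,
    finrank_euclideanSpace_fin]

/-- A dilation of `ℝⁿ` by `(C pⁿ) ^ (1 / p)` multiplies volumes by `exp (n (n log p + log C) / p)`,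
and the constant `C` does not enter the first-order behaviour. -/
theorem tendsto_div_log_mul_exp_sub_one (m a : ℝ) :
    Tendsto (fun p : ℝ => p / Real.log p * (Real.exp (m * ((m * Real.log p + a) / p)) - 1))
      atTop (𝓝 (m ^ 2)) := by
  set u : ℝ → ℝ := fun p => m * ((m * Real.log p + a) / p) with hu
  have hlog : Tendsto (fun p : ℝ => Real.log p / p) atTop (𝓝 0) :=
    Real.isLittleO_log_id_atTop.tendsto_div_nhds_zero
  have hu0 : Tendsto u atTop (𝓝 0) := by
    have h := ((hlog.const_mul m).add (tendsto_inv_atTop_zero.const_mul a)).const_mul m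
    simp only [mul_zero, add_zero] at h
    refine h.congr fun p => ?_
    simp only [hu]
    ring
  have hslope : Tendsto (fun p => dslope Real.exp 0 (u p)) atTop (𝓝 1) := by
    have h := (continuousAt_dslope_same.2 (Real.differentiable_exp 0)).tendsto
    rw [dslope_same, Real.deriv_exp, Real.exp_zero] at h
    exact h.comp hu0
  have hlin : Tendsto (fun p : ℝ => m * (m + a * (Real.log p)⁻¹)) atTop (𝓝 (m ^ 2)) := by
    have h := (((Real.tendsto_log_atTop.inv_tendsto_atTop).const_mul a).const_add m).const_mul m
    simpa [pow_two] using h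
  have h := hlin.mul hslope
  rw [mul_one] at h
  refine h.congr' ?_
  filter_upwards [eventually_gt_atTop 1] with p hp
  have hl : Real.log p ≠ 0 := (Real.log_pos hp).ne'
  have hp0 : p ≠ 0 := by linarith
  have hs := sub_smul_dslope Real.exp 0 (u p)
  rw [Real.exp_zero, sub_zero, smul_eq_mul] at hs
  change _ = p / Real.log p * (Real.exp (u p) - 1)
  rw [← hs, ← mul_assoc]
  congr 1
  simp only [hu]
  field_simp

/-! ### Upper bound for the volume -/

theorem one_half_le_volume_real_inner_nonneg {n : ℕ} {K : Set (EuclideanSpace ℝ (Fin n))}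
    (hsymm : IsOriginSymmetric K) (hvol : volume K = 1) (θ : EuclideanSpace ℝ (Fin n)) :
    1 / 2 ≤ volume.real (K ∩ {x | 0 ≤ ⟪x, θ⟫}) := by
  set H := K ∩ {x | 0 ≤ ⟪x, θ⟫}
  have hsub : K ⊆ H ∪ -H := by
    intro x hx
    rcases le_total 0 ⟪x, θ⟫ with h | h
    · exact Or.inl ⟨hx, h⟩
    · exact Or.inr ⟨hsymm x hx, by simpa [inner_neg_left] using h⟩
  have hH : volume H ≠ ⊤ :=
    ((measure_mono Set.inter_subset_left).trans_lt (hvol ▸ ENNReal.one_lt_top)).ne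
  have h1 : volume.real K ≤ volume.real H + volume.real (-H) :=
    (measureReal_mono hsub (measure_union_ne_top hH (by rwa [Measure.measure_neg]))).trans
      (measureReal_union_le _ _)
  have h2 : volume.real (-H) = volume.real H := by
    simp only [measureReal_def, Measure.measure_neg]
  have h3 : volume.real K = 1 := by simp [measureReal_def, hvol]
  linarith

/-- Lower bound for the `p`-th moment by the width of `K`. Shrinking the half `{0 ≤ ⟪x, θ⟫}` of `K`
towards `v` with ratio `1 / p` gives a part of `K` of volume at least `p⁻ⁿ / 2` on which
`⟪x, θ⟫ ≥ (1 - 1 / p) ⟪v, θ⟫`, and `(1 - 1 / p) ^ p ≥ 1 / 4`. -/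
theorem inner_rpow_le_integral {n : ℕ} {p : ℝ} (hp : 2 ≤ p)
    {K : Set (EuclideanSpace ℝ (Fin n))} (hK : IsCompact K) (hconv : Convex ℝ K)
    (hsymm : IsOriginSymmetric K) (hvol : volume K = 1) {v θ : EuclideanSpace ℝ (Fin n)}
    (hv : v ∈ K) (hvθ : 0 ≤ ⟪v, θ⟫) :
    ⟪v, θ⟫ ^ p ≤ 8 * p ^ n * ∫ x in K, |⟪x, θ⟫| ^ p := by
  have hp0 : 0 < p := by linarith
  have hpinv : p⁻¹ ≤ 1 / 2 := by
    rw [one_div]; exact inv_anti₀ two_pos hp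
  have hpinv0 : 0 < p⁻¹ := inv_pos.2 hp0
  set H := K ∩ {x | 0 ≤ ⟪x, θ⟫} with hH
  set E := AffineMap.homothety v p⁻¹ '' H with hE
  have hHc : IsCompact H := hK.inter_right (isClosed_le continuous_const (by fun_prop))
  have hEc : IsCompact E := hHc.image (AffineMap.continuous_of_finiteDimensional _)
  have heq (x : EuclideanSpace ℝ (Fin n)) :
      AffineMap.homothety v p⁻¹ x = (1 - p⁻¹) • v + p⁻¹ • x := by
    rw [AffineMap.homothety_apply, vsub_eq_sub, vadd_eq_add]
    module
  have hEK : E ⊆ K := by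
    rintro _ ⟨x, hx, rfl⟩
    rw [heq]
    exact hconv hv hx.1 (by linarith) hpinv0.le (by ring)
  have hint := integrableOn_abs_inner_rpow hp0.le hK θ
  have hge : ((1 - p⁻¹) * ⟪v, θ⟫) ^ p * volume.real E ≤ ∫ x in E, |⟪x, θ⟫| ^ p := by
    refine setIntegral_ge_of_const_le_real hEc.measurableSet hEc.measure_lt_top.ne ?_
      (hint.mono_set hEK)
    rintro _ ⟨x, hx, rfl⟩
    have hx2 : 0 ≤ ⟪x, θ⟫ := hx.2
    refine Real.rpow_le_rpow (mul_nonneg (by linarith) hvθ) (le_trans ?_ (le_abs_self _)) hp0.le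
    rw [heq, inner_add_left, real_inner_smul_left, real_inner_smul_left]
    have := mul_nonneg hpinv0.le hx2
    linarith
  have hmono : ∫ x in E, |⟪x, θ⟫| ^ p ≤ ∫ x in K, |⟪x, θ⟫| ^ p :=
    setIntegral_mono_set hint (ae_of_all _ fun x => by positivity) hEK.eventuallyLE
  have hvolE : volume.real E = (p ^ n)⁻¹ * volume.real H := by
    rw [measureReal_def, hE, Measure.addHaar_image_homothety, ENNReal.toReal_mul,
      ENNReal.toReal_ofReal (abs_nonneg _), abs_of_pos (by positivity), ← measureReal_def,
      finrank_euclideanSpace_fin, inv_pow]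
  have hhalf := one_half_le_volume_real_inner_nonneg hsymm hvol θ
  have hquarter : (1 / 4 : ℝ) ≤ (1 - p⁻¹) ^ p := by
    -- Bernoulli's inequality with exponent `p` itself only gives `0`, so it is used with `p / 2`.
    have hB := one_add_mul_self_le_rpow_one_add (s := -p⁻¹) (by linarith) (p := p / 2) (by linarith)
    have h1 : 1 + p / 2 * -p⁻¹ = 1 / 2 := by field_simp; norm_num
    rw [h1, ← sub_eq_add_neg] at hB
    calc (1 / 4 : ℝ) = (1 / 2) ^ 2 := by norm_num
      _ ≤ ((1 - p⁻¹) ^ (p / 2)) ^ 2 := by gcongr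
      _ = (1 - p⁻¹) ^ p := by
        rw [← Real.rpow_mul_natCast (by linarith)]
        congr 1
        push_cast
        ring
  rw [Real.mul_rpow (by linarith) hvθ, hvolE] at hge
  have hvp : 0 ≤ ⟪v, θ⟫ ^ p := Real.rpow_nonneg hvθ p
  have hpn : 0 < p ^ n := by positivity
  calc ⟪v, θ⟫ ^ p = 8 * p ^ n * (1 / 4 * ⟪v, θ⟫ ^ p * ((p ^ n)⁻¹ * (1 / 2))) := by
        field_simp; ring
    _ ≤ 8 * p ^ n * ((1 - p⁻¹) ^ p * ⟪v, θ⟫ ^ p * ((p ^ n)⁻¹ * volume.real H)) := by gcongr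
    _ ≤ _ := by
      gcongr
      exact hge.trans hmono

/-- The upper bound: the dilation factor is `(8 pⁿ) ^ (1 / p)`. -/
theorem polarBody_lpCentroidBody_subset_smul {n : ℕ} {p : ℝ} (hp : 2 ≤ p)
    {K : Set (EuclideanSpace ℝ (Fin n))} (hK : IsCompact K) (hconv : Convex ℝ K)
    (hsymm : IsOriginSymmetric K) (hvol : volume K = 1) :
    polarBody (lpCentroidBody p K) ⊆
      Real.exp ((n * Real.log p + Real.log 8) / p) • polarBody K := by
  have hp0 : 0 < p := by linarith
  rw [polarBody_lpCentroidBody (by linarith) hK]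
  intro θ hθ
  set r := Real.exp ((n * Real.log p + Real.log 8) / p) with hr
  have hr0 : 0 < r := Real.exp_pos _
  rw [Set.mem_smul_set_iff_inv_smul_mem₀ hr0.ne']
  intro v hv
  rw [real_inner_smul_right, inv_mul_le_iff₀ hr0, mul_one]
  rcases le_total ⟪v, θ⟫ 0 with h | h
  · exact h.trans hr0.le
  rw [← Real.rpow_le_rpow_iff h hr0.le hp0, hr, exp_rpow_scale hp0, Real.exp_log (by norm_num)]
  have hθ1 : ∫ x in K, |⟪x, θ⟫| ^ p ≤ 1 := hθ
  calc ⟪v, θ⟫ ^ p ≤ 8 * p ^ n * ∫ x in K, |⟪x, θ⟫| ^ p :=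
        inner_rpow_le_integral hp hK hconv hsymm hvol hv h
    _ ≤ 8 * p ^ n * 1 := by gcongr
    _ = _ := mul_one _

/-! ### Directions exposing a single vertex -/

/-- The cone of directions `θ` in which some `v ∈ S` beats all other points of `S` by the relative
margin `δ`. The value `⟪v, θ⟫` is required to be nonnegative, so that the cones decrease in `δ`; the
direction `θ = 0` belongs to every such cone when `S` is nonempty. -/
def exposedNormals {n : ℕ} (S : Set (EuclideanSpace ℝ (Fin n))) (δ : ℝ) :
    Set (EuclideanSpace ℝ (Fin n)) :=
  {θ | ∃ v ∈ S, 0 ≤ ⟪v, θ⟫ ∧ ∀ w ∈ S, w ≠ v → ⟪w, θ⟫ ≤ (1 - δ) * ⟪v, θ⟫}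

theorem isClosed_exposedNormals {n : ℕ} {S : Set (EuclideanSpace ℝ (Fin n))} (hS : S.Finite)
    (δ : ℝ) : IsClosed (exposedNormals S δ) := by
  have : exposedNormals S δ = ⋃ v ∈ S, ({θ | 0 ≤ ⟪v, θ⟫} ∩
      ⋂ w ∈ S, ⋂ _ : w ≠ v, {θ | ⟪w, θ⟫ ≤ (1 - δ) * ⟪v, θ⟫}) := by
    ext θ
    simp only [exposedNormals, Set.mem_iUnion, Set.mem_inter_iff, Set.mem_iInter,
      Set.mem_ofPred_eq, exists_prop]
  rw [this]
  refine hS.isClosed_biUnion fun v _ => (isClosed_le continuous_const (by fun_prop)).inter ?_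
  exact isClosed_biInter fun w _ => isClosed_iInter fun _ => isClosed_le (by fun_prop) (by fun_prop)

theorem exposedNormals_anti {n : ℕ} (S : Set (EuclideanSpace ℝ (Fin n))) :
    Antitone (exposedNormals S) := by
  rintro δ δ' h θ ⟨v, hv, h0, hw⟩
  exact ⟨v, hv, h0, fun w hwS hne => (hw w hwS hne).trans (by gcongr)⟩

theorem smul_mem_exposedNormals {n : ℕ} {S : Set (EuclideanSpace ℝ (Fin n))} {δ r : ℝ}
    (hr : 0 ≤ r) {θ : EuclideanSpace ℝ (Fin n)} (hθ : θ ∈ exposedNormals S δ) :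
    r • θ ∈ exposedNormals S δ := by
  obtain ⟨v, hv, h0, hw⟩ := hθ
  refine ⟨v, hv, ?_, fun w hwS hne => ?_⟩
  · rw [real_inner_smul_right]
    positivity
  · rw [real_inner_smul_right, real_inner_smul_right, mul_left_comm]
    exact mul_le_mul_of_nonneg_left (hw w hwS hne) hr

theorem volume_setOf_inner_eq_inner {n : ℕ} {v w : EuclideanSpace ℝ (Fin n)} (h : v ≠ w) :
    volume {θ | ⟪v, θ⟫ = ⟪w, θ⟫} = 0 := by
  have hset : {θ | ⟪v, θ⟫ = ⟪w, θ⟫} = ((ℝ ∙ (v - w))ᗮ : Set (EuclideanSpace ℝ (Fin n))) := by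
    ext θ
    rw [SetLike.mem_coe, Submodule.mem_orthogonal_singleton_iff_inner_right, inner_sub_left,
      sub_eq_zero]
    rfl
  rw [hset]
  refine Measure.addHaar_submodule _ _ fun htop => ?_
  rw [Submodule.orthogonal_eq_top_iff, Submodule.span_singleton_eq_bot, sub_eq_zero] at htop
  exact h htop

/-- The left-hand side is convex in `x`, so the bound only has to be checked on `S`. -/
theorem inner_le_of_mem_convexHull {n : ℕ} {S : Set (EuclideanSpace ℝ (Fin n))}
    {v θ : EuclideanSpace ℝ (Fin n)} {c : ℝ}
    (hS : ∀ w ∈ S, ⟪w, θ⟫ + c * ‖w - v‖ ≤ ⟪v, θ⟫) (hc : 0 ≤ c) {x : EuclideanSpace ℝ (Fin n)}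
    (hx : x ∈ convexHull ℝ S) : ⟪x, θ⟫ + c * ‖x - v‖ ≤ ⟪v, θ⟫ := by
  have hf : ConvexOn ℝ Set.univ fun x : EuclideanSpace ℝ (Fin n) => ⟪x, θ⟫ + c * ‖x - v‖ := by
    refine ConvexOn.add ?_ (ConvexOn.smul hc ?_)
    · refine ⟨convex_univ, fun x _ y _ a b _ _ _ => le_of_eq ?_⟩
      simp only [inner_add_left, real_inner_smul_left, smul_eq_mul]
    · have h := (convexOn_univ_norm (E := EuclideanSpace ℝ (Fin n))).translate_left (-v)
      rw [Set.preimage_univ] at h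
      simp only [sub_eq_add_neg]
      exact h
  have hsub : S ⊆ {x | x ∈ Set.univ ∧ ⟪x, θ⟫ + c * ‖x - v‖ ≤ ⟪v, θ⟫} :=
    fun w hw => ⟨Set.mem_univ _, hS w hw⟩
  exact (convexHull_min hsub (hf.convex_le ⟪v, θ⟫) hx).2

/-- Off the finitely many hyperplanes `⟪v, θ⟫ = ⟪w, θ⟫`, the maximum of `⟪·, θ⟫` over the finite set
`S` is attained at one point only. -/
theorem ae_mem_iUnion_exposedNormals {n : ℕ} {S : Set (EuclideanSpace ℝ (Fin n))} (hS : S.Finite)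
    (h0 : (0 : EuclideanSpace ℝ (Fin n)) ∈ convexHull ℝ S) :
    ∀ᵐ θ, θ ∈ ⋃ N : ℕ, exposedNormals S (1 / ((N : ℝ) + 1)) := by
  have hae : ∀ᵐ θ : EuclideanSpace ℝ (Fin n), ∀ v ∈ S, ∀ w ∈ S, v ≠ w → ⟪v, θ⟫ ≠ ⟪w, θ⟫ := by
    refine (ae_ball_iff hS.countable).2 fun v _ => (ae_ball_iff hS.countable).2 fun w _ => ?_
    by_cases h : v = w
    · simp [h]
    · filter_upwards [measure_eq_zero_iff_ae_notMem.1 (volume_setOf_inner_eq_inner h)] with θ hθ _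
      exact hθ
  filter_upwards [hae] with θ hθ
  have hne : S.Nonempty := convexHull_nonempty_iff.1 ⟨0, h0⟩
  obtain ⟨v, hv, hmax⟩ := hS.exists_maximalFor (fun v => ⟪v, θ⟫) S hne
  have hmax' (w) (hw : w ∈ S) : ⟪w, θ⟫ ≤ ⟪v, θ⟫ :=
    (le_total ⟪w, θ⟫ ⟪v, θ⟫).elim id fun h => hmax hw h
  have hv0 : 0 ≤ ⟪v, θ⟫ := by
    simpa using inner_le_of_mem_convexHull (c := 0) (by simpa using hmax') le_rfl h0
  have hlim : Tendsto (fun N : ℕ => (1 - 1 / ((N : ℝ) + 1)) * ⟪v, θ⟫) atTop (𝓝 ⟪v, θ⟫) := by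
    simpa using ((tendsto_one_div_add_atTop_nhds_zero_nat (𝕜 := ℝ)).const_sub 1).mul_const ⟪v, θ⟫
  have hev : ∀ᶠ N : ℕ in atTop, ∀ w ∈ S, w ≠ v → ⟪w, θ⟫ ≤ (1 - 1 / ((N : ℝ) + 1)) * ⟪v, θ⟫ := by
    refine (eventually_all_finite hS).2 fun w hw => ?_
    by_cases h : w = v
    · simp [h]
    · filter_upwards [hlim.eventually_const_lt
        (lt_of_le_of_ne (hmax' w hw) (hθ w hw v hv h))] with N hN _
      exact hN.le
  obtain ⟨N, hN⟩ := hev.exists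
  exact Set.mem_iUnion.2 ⟨N, v, hv, hv0, hN⟩

/-! ### Upper bound for the moments -/

/-- Trades the growing exponent `p` for a fixed exponent `q` and a dilation by a factor of order
`p`, by Bernoulli's inequality. -/
theorem one_add_mul_norm_rpow_neg_le {n : ℕ} {c p q : ℝ} (hc : 0 ≤ c) (hq : 0 < q) (hqp : q ≤ p)
    (z : EuclideanSpace ℝ (Fin n)) :
    (1 + c * ‖z‖) ^ (-p) ≤ (1 + ‖(p * c / q) • z‖) ^ (-q) := by
  have hp : 0 < p := hq.trans_le hqp
  have hz : 0 ≤ c * ‖z‖ := by positivity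
  have hB := one_add_mul_self_le_rpow_one_add (s := c * ‖z‖) (by linarith) (p := p / q)
    ((one_le_div hq).2 hqp)
  rw [norm_smul, Real.norm_of_nonneg (by positivity), Real.rpow_neg (by positivity),
    Real.rpow_neg (by positivity)]
  refine inv_anti₀ (by positivity) ?_
  calc (1 + p * c / q * ‖z‖) ^ q = (1 + p / q * (c * ‖z‖)) ^ q := by congr 2; ring
    _ ≤ ((1 + c * ‖z‖) ^ (p / q)) ^ q := by gcongr
    _ = (1 + c * ‖z‖) ^ p := by rw [← Real.rpow_mul (by positivity), div_mul_cancel₀ _ hq.ne']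

/-- Follows from `1 - t ≤ (1 + t)⁻¹` at `x` if `⟪x, θ⟫ ≥ 0`, and at `-x` otherwise. -/
theorem abs_inner_rpow_le {n : ℕ} {p c : ℝ} (hp : 0 ≤ p) (hc : 0 ≤ c)
    {K : Set (EuclideanSpace ℝ (Fin n))} (hsymm : IsOriginSymmetric K)
    {v θ : EuclideanSpace ℝ (Fin n)} (hv : 0 ≤ ⟪v, θ⟫)
    (hK : ∀ x ∈ K, ⟪x, θ⟫ ≤ ⟪v, θ⟫ * (1 - c * ‖x - v‖)) {x : EuclideanSpace ℝ (Fin n)}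
    (hx : x ∈ K) :
    |⟪x, θ⟫| ^ p ≤ ⟪v, θ⟫ ^ p * ((1 + c * ‖x - v‖) ^ (-p) + (1 + c * ‖x + v‖) ^ (-p)) := by
  have key (y) (hy : y ∈ K) (h0 : 0 ≤ ⟪y, θ⟫) :
      ⟪y, θ⟫ ^ p ≤ ⟪v, θ⟫ ^ p * (1 + c * ‖y - v‖) ^ (-p) := by
    have hpos : 0 < 1 + c * ‖y - v‖ := by positivity
    rw [Real.rpow_neg hpos.le, ← Real.inv_rpow hpos.le, ← Real.mul_rpow hv (by positivity)]
    refine Real.rpow_le_rpow h0 ((hK y hy).trans (mul_le_mul_of_nonneg_left ?_ hv)) hp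
    rw [← one_div, le_div_iff₀ hpos]
    nlinarith [sq_nonneg (c * ‖y - v‖)]
  have hvp : 0 ≤ ⟪v, θ⟫ ^ p := Real.rpow_nonneg hv p
  have h1 : 0 ≤ (1 + c * ‖x - v‖) ^ (-p) := by positivity
  have h2 : 0 ≤ (1 + c * ‖x + v‖) ^ (-p) := by positivity
  rw [mul_add]
  rcases le_total 0 ⟪x, θ⟫ with h | h
  · rw [abs_of_nonneg h]
    exact (key x hx h).trans (le_add_of_nonneg_right (mul_nonneg hvp h2))
  · have hk := key (-x) (hsymm x hx) (by rwa [inner_neg_left, neg_nonneg])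
    rw [inner_neg_left, ← neg_add', norm_neg] at hk
    rw [abs_of_nonpos h]
    exact hk.trans (le_add_of_nonneg_left (mul_nonneg hvp h1))

/-- The `p`-th moment is at most of order `p⁻ⁿ`, uniformly over the directions in `K°` with margin
`δ`: such a `θ` decays linearly away from a vertex `v` of `K`, so that `|⟪x, θ⟫| ^ p` is bounded by a
fixed integrable profile, compressed by a factor of order `p` and placed at `v` and at `-v`. -/
theorem exists_integral_le_of_mem_exposedNormals {n : ℕ} {S : Set (EuclideanSpace ℝ (Fin n))}
    (hS : S.Finite) (hsymm : IsOriginSymmetric (convexHull ℝ S)) {δ : ℝ} (hδ : 0 < δ) :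
    ∃ C : ℝ, 0 < C ∧ ∀ p : ℝ, (n : ℝ) + 1 ≤ p → ∀ θ ∈ exposedNormals S δ,
      θ ∈ polarBody (convexHull ℝ S) →
      ∫ x in convexHull ℝ S, |⟪x, θ⟫| ^ p ≤ C / p ^ n := by
  obtain ⟨R, hR0, hR⟩ := hS.isBounded.exists_pos_norm_le
  set c : ℝ := δ / (2 * R) with hcdef
  have hc : 0 < c := by positivity
  -- Any fixed exponent above the dimension makes `(1 + ‖z‖) ^ (-q)` integrable.
  set q : ℝ := (n : ℝ) + 1 with hqdef
  have hq : 0 < q := by positivity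
  set g : EuclideanSpace ℝ (Fin n) → ℝ := fun z => (1 + ‖z‖) ^ (-q) with hg
  have hgint : Integrable g := integrable_one_add_norm (by simp [hqdef])
  have hg0 (z) : 0 ≤ g z := by simp only [hg]; positivity
  have hJ : 0 ≤ ∫ z, g z := integral_nonneg hg0
  -- The summand `1` only serves to make the constant positive.
  refine ⟨2 * (q / c) ^ n * (∫ z, g z) + 1, by positivity, fun p hp θ ⟨v, hv, hv0, hw⟩ hθ => ?_⟩
  have hp0 : 0 < p := hq.trans_le hp
  have hK : IsCompact (convexHull ℝ S) := hS.isCompact_convexHull ℝ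
  have hv1 : ⟪v, θ⟫ ≤ 1 := hθ v (subset_convexHull ℝ S hv)
  have hbound (x) (hx : x ∈ convexHull ℝ S) : ⟪x, θ⟫ ≤ ⟪v, θ⟫ * (1 - c * ‖x - v‖) := by
    have h := inner_le_of_mem_convexHull (v := v) (θ := θ) (c := ⟪v, θ⟫ * c) (fun w hwS => ?_)
      (by positivity) hx
    · linarith
    rcases eq_or_ne w v with rfl | hne
    · simp
    have hnorm : ‖w - v‖ ≤ 2 * R := by
      linarith [norm_sub_le w v, hR w hwS, hR v hv]
    have hcn : c * ‖w - v‖ ≤ δ := by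
      calc c * ‖w - v‖ ≤ c * (2 * R) := by gcongr
        _ = δ := by rw [hcdef]; field_simp
    nlinarith [hw w hwS hne, mul_le_mul_of_nonneg_left hcn hv0]
  set r : ℝ := p * c / q with hr
  have hr0 : 0 < r := by positivity
  have hgr : Integrable fun x => g (r • x) := hgint.comp_smul hr0.ne'
  have hint1 : Integrable fun x => g (r • (x - v)) := hgr.comp_sub_right v
  have hint2 : Integrable fun x => g (r • (x + v)) := hgr.comp_add_right v
  have hI : ∫ x, g (r • x) = (r ^ n)⁻¹ * ∫ z, g z := by
    rw [Measure.integral_comp_smul, abs_of_pos (by positivity), finrank_euclideanSpace_fin,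
      smul_eq_mul]
  have hpt (x) (hx : x ∈ convexHull ℝ S) :
      |⟪x, θ⟫| ^ p ≤ g (r • (x - v)) + g (r • (x + v)) := by
    refine (abs_inner_rpow_le hp0.le hc.le hsymm hv0 hbound hx).trans ?_
    have hle := add_le_add (one_add_mul_norm_rpow_neg_le hc.le hq hp (x - v))
      (one_add_mul_norm_rpow_neg_le hc.le hq hp (x + v))
    exact (mul_le_of_le_one_left (by positivity) (Real.rpow_le_one hv0 hv1 hp0.le)).trans hle
  calc ∫ x in convexHull ℝ S, |⟪x, θ⟫| ^ p
      ≤ ∫ x in convexHull ℝ S, (g (r • (x - v)) + g (r • (x + v))) :=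
        setIntegral_mono_on (integrableOn_abs_inner_rpow hp0.le hK θ)
          (hint1.add hint2).integrableOn hK.measurableSet hpt
    _ ≤ ∫ x, (g (r • (x - v)) + g (r • (x + v))) :=
        setIntegral_le_integral (hint1.add hint2) (ae_of_all _ fun x => add_nonneg (hg0 _) (hg0 _))
    _ = 2 * ((r ^ n)⁻¹ * ∫ z, g z) := by
        rw [integral_add hint1 hint2, integral_sub_right_eq_self (fun x => g (r • x)),
          integral_add_right_eq_self (fun x => g (r • x)), hI, two_mul]
    _ = (2 * (q / c) ^ n * ∫ z, g z) / p ^ n := by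
        rw [hr, div_pow, div_pow, mul_pow]
        field_simp
    _ ≤ _ := by gcongr; linarith

/-! ### Lower bound for the volume -/

/-- The lower bound: `Z_p°(K)` contains the dilation of the part of `K°` in the cone
`exposedNormals S δ` by a factor `(C pⁿ) ^ (1 / p)`, and also all of `K°` outside that cone. The two
pieces are disjoint because the cone is invariant under dilation. -/
theorem exists_volume_real_ge {n : ℕ} {S : Set (EuclideanSpace ℝ (Fin n))}
    (hS : S.Finite) (hsymm : IsOriginSymmetric (convexHull ℝ S))
    (hvol : volume (convexHull ℝ S) = 1) {δ : ℝ} (hδ : 0 < δ) :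
    ∃ a : ℝ, ∀ p : ℝ, (n : ℝ) + 2 ≤ p →
      (Real.exp (n * ((n * Real.log p + a) / p)) - 1) *
          volume.real (polarBody (convexHull ℝ S) ∩ exposedNormals S δ) ≤
        volume.real (polarBody (lpCentroidBody p (convexHull ℝ S))) -
          volume.real (polarBody (convexHull ℝ S)) := by
  obtain ⟨C, hC, hle⟩ := exists_integral_le_of_mem_exposedNormals hS hsymm hδ
  set K := convexHull ℝ S with hKdef
  have hK : IsCompact K := hS.isCompact_convexHull ℝ
  have hconv : Convex ℝ K := convex_convexHull ℝ S
  have hfin : volume (polarBody K) ≠ ⊤ := (isBounded_polarBody_of_mem_nhds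
    (hconv.mem_nhds_zero_of_volume_ne_zero hsymm (by simp [hvol]))).measure_lt_top.ne
  set A := exposedNormals S δ
  have hA : IsClosed A := isClosed_exposedNormals hS δ
  refine ⟨-Real.log C, fun p hp => ?_⟩
  have hp2 : 2 ≤ p := by linarith [n.cast_nonneg (α := ℝ)]
  have hp0 : 0 < p := by linarith
  set r := Real.exp ((n * Real.log p + -Real.log C) / p) with hr
  have hr0 : 0 < r := Real.exp_pos _
  have hrp : r ^ p = p ^ n / C := by
    rw [hr, exp_rpow_scale hp0, Real.exp_neg, Real.exp_log hC]
    ring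
  have hZ := polarBody_lpCentroidBody (p := p) (by linarith) hK
  have hZfin : volume (polarBody (lpCentroidBody p K)) ≠ ⊤ := by
    refine ((measure_mono
      (polarBody_lpCentroidBody_subset_smul hp2 hK hconv hsymm hvol)).trans_lt ?_).ne
    rw [Measure.addHaar_smul]
    exact ENNReal.mul_lt_top ENNReal.ofReal_lt_top hfin.lt_top
  have hsub1 : r • (polarBody K ∩ A) ⊆ polarBody (lpCentroidBody p K) := by
    rintro _ ⟨θ, ⟨hθK, hθA⟩, rfl⟩
    rw [hZ]
    have h1 : ∫ x in K, |⟪x, r • θ⟫| ^ p = r ^ p * ∫ x in K, |⟪x, θ⟫| ^ p := by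
      rw [← integral_const_mul]
      congr 1 with x
      rw [real_inner_smul_right, abs_mul, abs_of_pos hr0, Real.mul_rpow hr0.le (abs_nonneg _)]
    change ∫ x in K, |⟪x, r • θ⟫| ^ p ≤ 1
    rw [h1, hrp]
    calc p ^ n / C * ∫ x in K, |⟪x, θ⟫| ^ p ≤ p ^ n / C * (C / p ^ n) := by
          gcongr
          exact hle p (by linarith) θ hθA hθK
      _ = 1 := by field_simp
  have hsub2 : polarBody K \ A ⊆ polarBody (lpCentroidBody p K) := by
    rintro θ ⟨hθ, -⟩
    rw [hZ]
    have hpt (x) (hx : x ∈ K) : |⟪x, θ⟫| ^ p ≤ 1 := by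
      refine Real.rpow_le_one (abs_nonneg _) (abs_le'.2 ⟨hθ x hx, ?_⟩) hp0.le
      rw [← inner_neg_left]
      exact hθ _ (hsymm x hx)
    have h := setIntegral_mono_on (integrableOn_abs_inner_rpow hp0.le hK θ)
      (integrableOn_const (C := (1 : ℝ)) hK.measure_lt_top.ne) hK.measurableSet hpt
    simpa [measureReal_def, hvol] using h
  have hdisj : Disjoint (r • (polarBody K ∩ A)) (polarBody K \ A) := by
    rw [Set.disjoint_left]
    rintro _ ⟨θ, ⟨-, hθA⟩, rfl⟩ h
    exact h.2 (smul_mem_exposedNormals hr0.le hθA)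
  have hmeas : MeasurableSet (polarBody K \ A) :=
    (isClosed_polarBody K).measurableSet.diff hA.measurableSet
  have hunion := measureReal_mono (Set.union_subset hsub1 hsub2) hZfin
  rw [measureReal_union hdisj hmeas (ne_top_of_le_ne_top hZfin (measure_mono hsub1))
    (ne_top_of_le_ne_top hfin (measure_mono Set.sdiff_subset)), volume_real_smul hr0.le, hr,
    exp_pow_scale] at hunion
  have hsplit := measureReal_inter_add_sdiff (μ := volume) (s := polarBody K) hA.measurableSet hfin
  linarith

/-! ### The limit -/

theorem theorem1p1 (n : ℕ) (K : Set (EuclideanSpace ℝ (Fin n)))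
    (hK : IsPolytope K) (hsymm : IsOriginSymmetric K) (hvol : volume K = 1) :
    Tendsto
      (fun p : ℝ => p / Real.log p *
        ((volume (polarBody (lpCentroidBody p K))).toReal - (volume (polarBody K)).toReal))
      atTop (𝓝 ((n : ℝ) ^ 2 * (volume (polarBody K)).toReal)) := by
  obtain ⟨S, hS, rfl⟩ := hK
  set K := convexHull ℝ S with hKdef
  have hK : IsCompact K := hS.isCompact_convexHull ℝ
  have hconv : Convex ℝ K := convex_convexHull ℝ S
  have hnhds : K ∈ 𝓝 0 := hconv.mem_nhds_zero_of_volume_ne_zero hsymm (by simp [hvol])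
  have hfin : volume (polarBody K) ≠ ⊤ := (isBounded_polarBody_of_mem_nhds hnhds).measure_lt_top.ne
  simp only [← measureReal_def]
  have hcoef : ∀ᶠ p : ℝ in atTop, 0 ≤ p / Real.log p := by
    filter_upwards [eventually_ge_atTop 1] with p hp
    exact div_nonneg (by linarith) (Real.log_nonneg hp)
  -- Values below the limit are exceeded by the bound for a small margin `δ`; values above it are
  -- treated by the inclusion in a dilate of `K°`.
  refine tendsto_order.2 ⟨fun b hb => ?_, fun b hb => ?_⟩
  · have hA : Tendsto (fun N : ℕ => volume.real (polarBody K ∩ exposedNormals S (1 / ((N : ℝ) + 1))))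
        atTop (𝓝 (volume.real (polarBody K))) := by
      have hmono : Monotone fun N : ℕ => polarBody K ∩ exposedNormals S (1 / ((N : ℝ) + 1)) :=
        fun N M h => Set.inter_subset_inter_right _
          (exposedNormals_anti S (Nat.one_div_le_one_div h))
      have h := tendsto_measure_iUnion_atTop (μ := volume) hmono
      rw [← Set.inter_iUnion, Set.inter_comm, Measure.measure_inter_eq_of_ae
        (ae_mem_iUnion_exposedNormals hS (mem_of_mem_nhds hnhds))] at h
      exact (ENNReal.tendsto_toReal hfin).comp h
    obtain ⟨N, hN⟩ := ((hA.const_mul ((n : ℝ) ^ 2)).eventually_const_lt hb).exists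
    obtain ⟨a, ha⟩ := exists_volume_real_ge hS hsymm hvol (δ := 1 / ((N : ℝ) + 1)) (by positivity)
    filter_upwards [((tendsto_div_log_mul_exp_sub_one n a).mul_const _).eventually_const_lt hN,
      hcoef, eventually_ge_atTop ((n : ℝ) + 2)] with p hlt hp0 hp
    rw [mul_assoc] at hlt
    exact hlt.trans_le (mul_le_mul_of_nonneg_left (ha p hp) hp0)
  · filter_upwards [((tendsto_div_log_mul_exp_sub_one n (Real.log 8)).mul_const
      (volume.real (polarBody K))).eventually_lt_const hb, hcoef, eventually_ge_atTop 2]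
      with p hlt hp0 hp
    refine lt_of_le_of_lt ?_ hlt
    rw [mul_assoc]
    refine mul_le_mul_of_nonneg_left ?_ hp0
    have h := measureReal_mono (polarBody_lpCentroidBody_subset_smul hp hK hconv hsymm hvol)
      (μ := volume) (by
        rw [Measure.addHaar_smul]
        exact ENNReal.mul_ne_top ENNReal.ofReal_ne_top hfin)
    rw [volume_real_smul (Real.exp_pos _).le, exp_pow_scale] at h
    linarith
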